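/- Let $\mathrm{Sym}$ be the space of real symmetric $3\times3$ (stress) tensors. For $\sigma\in\mathrm{Sym}$ put $S=\sigma-\tfrac{1}{3}(\operatorname{tr}\sigma)I$, $J_2=\tfrac12\operatorname{tr}S^2$, $J_3=\tfrac13\operatorname{tr}S^3$, $p=-\tfrac13\operatorname{tr}\sigma$, $q=\sqrt{3J_2}$ and $\theta=\tfrac13\arccos\!\big(\tfrac{3\sqrt3}{2}J_3/J_2^{3/2}\big)\in[0,\pi/3]$ (when $S=0$ the value of $\theta$ is immaterial, since $q=0$). Let $D\subseteq\mathbb R$ be a non-empty interval and let $f:D\to\mathbb R$ be continuous on $D$ and twice differentiable in the interior of $D$ ($f=+\infty$ outside $D$). Let $g$ be continuous and strictly positive on $[0,\pi/3]$ and twice differentiable at all points of $(0,\pi/3)$ except possibly at the points of a finite set $E\subset(0,\pi/3)$. Consider $F(\sigma)=f(p)+q/g(\theta)$, defined on the convex set of those $\sigma\in\mathrm{Sym}$ for which $p\in D$. (1) $F$ is convex if and only if all of the following hold: - $f''\ge0$ in the interior of $D$; - $g^2+2g'^2-gg''\ge0$ on $(0,\pi/3)\setminus E$; - the one-sided derivatives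 $g'(0)$ and $g'(\pi/3)$ exist (and are finite), with $g'(0)\le0$ and $g'(\pi/3)\ge0$; - at every corner of $g$, that is, at every $\theta_i\in E$ at which $g$ is not differentiable, the left and right derivatives $g'_-(\theta_i)$ and $g'_+(\theta_i)$ exist (and are finite) and $g'_-(\theta_i)>g'_+(\theta_i)$. (2) Suppose in addition that $f\le0$ on $D$ and that $f$ is negative somewhere on $D$. Then $F$ is convex if and only if the meridian and deviatoric sections of the yield surface $F=0$ are convex, that is, for every $\theta\in[0,\pi/3]$ the region $\{(p,q): p\in D,\ q\ge0,\ f(p)+q/g(\theta)\le0\}$ is convex, and for every $p_0\in D$ the set of all triples of principal stresses $(\sigma_1,\sigma_2,\sigma_3)\in\mathbb R^3$ with $p=p_0$ and $F\le0$ is convex. -/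

import Mathlib

noncomputable section

namespace YieldFunction

/-- Second-order tensors on three-dimensional space, written in an orthonormal basis. -/
abbrev Tensor := Matrix (Fin 3) (Fin 3) ℝ

/-- Deviatoric stress `S = σ - (tr σ / 3) I`. -/
def dev (σ : Tensor) : Tensor := σ - (σ.trace / 3) • (1 : Tensor)

/-- Second invariant of the deviatoric stress, `J₂ = tr S² / 2`. -/
def J2 (σ : Tensor) : ℝ := (1 / 2) * ((dev σ) ^ 2).trace

/-- Third invariant of the deviatoric stress, `J₃ = tr S³ / 3`. -/
def J3 (σ : Tensor) : ℝ := (1 / 3) * ((dev σ) ^ 3).trace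

/-- Mean pressure `p = - tr σ / 3`. -/
def pInv (σ : Tensor) : ℝ := -σ.trace / 3

/-- Deviatoric invariant `q = √(3 J₂)`. -/
def qInv (σ : Tensor) : ℝ := Real.sqrt (3 * J2 σ)

/-- Lode angle `θ = (1/3) arccos ((3√3/2) J₃ / J₂^(3/2)) ∈ [0, π/3]`.  On the hydrostatic axis
`S = 0` the angle is immaterial because `q = 0` there. -/
def thetaInv (σ : Tensor) : ℝ :=
  (1 / 3) * Real.arccos ((3 * Real.sqrt 3 / 2) * (J3 σ / (J2 σ) ^ (3 / 2 : ℝ)))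

/-- The function `F(σ) = f(p) + q / g(θ)`. -/
def yieldFun (f g : ℝ → ℝ) (σ : Tensor) : ℝ :=
  f (pInv σ) + qInv σ / g (thetaInv σ)

/-- The symmetric stress tensors whose pressure lies in the domain `D` of `f`
(`F` is understood to be `+∞` at the other symmetric tensors). -/
def domain (D : Set ℝ) : Set Tensor := {σ | σ.IsSymm ∧ pInv σ ∈ D}

/-- The region bounded by the deviatoric section, at pressure `p`, of the surface `F = 0`,
in the space of the principal stresses `(σ₁, σ₂, σ₃)`. -/
def deviatoricSection (f g : ℝ → ℝ) (p : ℝ) : Set (Fin 3 → ℝ) :=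
  {s | pInv (Matrix.diagonal s) = p ∧ yieldFun f g (Matrix.diagonal s) ≤ 0}

/-- The region bounded by the meridian section, at Lode angle `θ`, of the surface `F = 0`,
in the half-plane of the coordinates `(p, q)`, `q ≥ 0`. -/
def meridianSection (D : Set ℝ) (f g : ℝ → ℝ) (θ : ℝ) : Set (ℝ × ℝ) :=
  {z | z.1 ∈ D ∧ 0 ≤ z.2 ∧ f z.1 + z.2 / g θ ≤ 0}

end YieldFunction

end

/-! ### Convexity from local supports and from sublevel sets -/

section

open Set Filter Topology Matrix

/-! The term `q / g(θ)` is invariant under orthogonal conjugation. By the spectral theorem and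
Birkhoff's theorem, such a function is convex on symmetric matrices once it is convex on diagonal
ones (`convexOn_isSymm_of_convexOn_diagonal`). On diagonal matrices it is a function `planeGauge g`
of the projection `z` onto the deviatoric plane, with `q = |z|` and `cos 3θ = Re z³ / |z|³`.
Hydrostatic stresses isolate `f`, and stresses of fixed pressure isolate the gauge, so `F` is convex
iff `f` and `planeGauge g` both are (`convexOn_yieldFun_iff`).

In polar coordinates the gauge is `r u(α)`, where `u` is `1 / g` unfolded by reflections. On the
tangent line to the unit circle at angle `θ` it becomes `k(t) = √(1 + t²) u(θ + arctan t)`, and `k''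
= (u + u'') / (1 + t²)^(3/2)`. Since `u + u'' = (g² + 2g'² - g g'') / g³`, convexity of the gauge
gives the second-order condition. It also gives one-sided derivatives of `u`, left ≤ right. Passing
to `g` reverses this order, and the mirror symmetry of `u` about `0` and `π/3` turns it into the
sign conditions there.

Conversely, these conditions place `u` locally above some `u(θ) cos φ + m sin φ`. Multiplied by `r`,
this is a linear function on the plane, so the gauge has a local linear support at every point. For
a continuous function that implies convexity (`convexOn_planeGauge_iff`).

For the sections, a positively homogeneous nonnegative function is convex as soon as one sublevel
set at a positive level is, and `f` is read off the upper boundary `q = -g(θ) f(p)` of a meridian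
region. -/

theorem nonpos_of_locally_supported {d : ℝ → ℝ} (hc : ContinuousOn d (Icc 0 1))
    (h0 : d 0 ≤ 0) (h1 : d 1 ≤ 0)
    (hs : ∀ t ∈ Ioo (0 : ℝ) 1, ∃ m, ∀ᶠ s in 𝓝 t, d t + m * (s - t) ≤ d s) :
    ∀ t ∈ Icc (0 : ℝ) 1, d t ≤ 0 := by
  obtain ⟨c₀, hc₀, hmax⟩ := isCompact_Icc.exists_isMaxOn (nonempty_Icc.2 zero_le_one) hc
  by_contra! hcon
  obtain ⟨t, ht, htpos⟩ := hcon
  have hM : 0 < d c₀ := htpos.trans_le (hmax ht)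
  -- The leftmost maximum point `c` is interior. Looking right of `c`, the support has slope `m ≤
  -- 0`; looking left, it then forces another maximum point, contradicting the choice of `c`.
  set S := Icc (0 : ℝ) 1 ∩ d ⁻¹' {d c₀} with hS
  have hSc : IsClosed S := hc.preimage_isClosed_of_isClosed isClosed_Icc isClosed_singleton
  have hSb : BddBelow S := ⟨0, fun x hx => hx.1.1⟩
  have hcS : sInf S ∈ S := hSc.csInf_mem ⟨c₀, hc₀, rfl⟩ hSb
  set c := sInf S
  have hdc : d c = d c₀ := hcS.2
  have hcI : c ∈ Ioo (0 : ℝ) 1 := by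
    refine ⟨lt_of_le_of_ne hcS.1.1 ?_, lt_of_le_of_ne hcS.1.2 ?_⟩
    · intro h; rw [← h] at hdc; linarith
    · intro h; rw [h] at hdc; linarith
  obtain ⟨m, hm⟩ := hs c hcI
  obtain ⟨ε, hε, hball⟩ := Metric.eventually_nhds_iff.1 (hm.and (Ioo_mem_nhds hcI.1 hcI.2))
  have hr := hball (y := c + ε / 2) (by rw [Real.dist_eq, add_sub_cancel_left, abs_of_pos] <;> linarith)
  have hl := hball (y := c - ε / 2)
    (by rw [Real.dist_eq, sub_sub_cancel_left, abs_neg, abs_of_pos] <;> linarith)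
  have hr' : d (c + ε / 2) ≤ d c₀ := hmax (Ioo_subset_Icc_self hr.2)
  have hl' : d (c - ε / 2) ≤ d c₀ := hmax (Ioo_subset_Icc_self hl.2)
  have hlS : c - ε / 2 ∈ S := by
    refine ⟨Ioo_subset_Icc_self hl.2, le_antisymm hl' ?_⟩
    nlinarith [hr.1, hl.1]
  linarith [csInf_le hSb hlS]

/-- Along a segment, `Φ` minus its chord is still locally supported by affine functions and vanishes
at the ends, so it is nonpositive. -/
theorem convexOn_of_locally_supported {V : Type*} [NormedAddCommGroup V] [NormedSpace ℝ V]
    {Φ : V → ℝ} (hc : Continuous Φ)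
    (hs : ∀ z, ∃ l : V →ₗ[ℝ] ℝ, ∀ᶠ w in 𝓝 z, Φ z + l (w - z) ≤ Φ w) :
    ConvexOn ℝ univ Φ := by
  refine ⟨convex_univ, fun x _ y _ a b ha hb hab => ?_⟩
  have hline : Continuous fun t : ℝ => x + t • (y - x) := by fun_prop
  have key := nonpos_of_locally_supported
    (d := fun t => Φ (x + t • (y - x)) - ((1 - t) * Φ x + t * Φ y)) (by fun_prop) (by simp)
    (by simp) ?_ b ⟨hb, by linarith⟩
  · have e : x + b • (y - x) = a • x + b • y := by
      rw [← eq_sub_iff_add_eq] at hab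
      rw [hab]; module
    rw [e, ← hab] at key
    simp only [smul_eq_mul]
    linarith
  · intro t _
    obtain ⟨l, hl⟩ := hs (x + t • (y - x))
    refine ⟨l (y - x) - (Φ y - Φ x), ?_⟩
    filter_upwards [hline.continuousAt.eventually hl] with s hs
    have e : x + s • (y - x) - (x + t • (y - x)) = (s - t) • (y - x) := by module
    rw [e, map_smul, smul_eq_mul] at hs
    linarith

theorem ConvexOn.deriv_deriv_nonneg {D : Set ℝ} {f : ℝ → ℝ} (hf : ConvexOn ℝ D f) (hD : IsOpen D)
    (hd : ∀ x ∈ D, DifferentiableAt ℝ f x) {x : ℝ} (hx : x ∈ D) : 0 ≤ deriv (deriv f) x := by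
  have hm := hf.monotoneOn_deriv hd
  rw [← derivWithin_of_isOpen hD hx]
  exact hm.derivWithin_nonneg

/-- Scaling `x` and `y` into the sublevel set and combining with weights proportional to their
gauges gives subadditivity; homogeneity then gives convexity. -/
theorem convexOn_of_convex_sublevel {V : Type*} [AddCommGroup V] [Module ℝ V] {Φ : V → ℝ}
    (hΦ : ∀ z, 0 ≤ Φ z) (hom : ∀ (c : ℝ) z, 0 ≤ c → Φ (c • z) = c * Φ z) {r : ℝ} (hr : 0 < r)
    (hconv : Convex ℝ {z | Φ z ≤ r}) : ConvexOn ℝ univ Φ := by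
  have hadd : ∀ x y, Φ (x + y) ≤ Φ x + Φ y := by
    intro x y
    -- The `ε` keeps the scaling denominators positive, since `Φ` may vanish at `x` or `y`.
    refine le_of_forall_pos_le_add fun ε hε => ?_
    have hA : 0 < Φ x + ε / 2 := by linarith [hΦ x]
    have hB : 0 < Φ y + ε / 2 := by linarith [hΦ y]
    set A := Φ x + ε / 2
    set B := Φ y + ε / 2
    have hx : (r / A) • x ∈ {z | Φ z ≤ r} := by
      rw [mem_ofPred_eq, hom _ _ (by positivity), div_mul_eq_mul_div, div_le_iff₀ hA]
      exact mul_le_mul_of_nonneg_left (by simp only [A]; linarith) hr.le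
    have hy : (r / B) • y ∈ {z | Φ z ≤ r} := by
      rw [mem_ofPred_eq, hom _ _ (by positivity), div_mul_eq_mul_div, div_le_iff₀ hB]
      exact mul_le_mul_of_nonneg_left (by simp only [B]; linarith) hr.le
    have h := hconv hx hy (a := A / (A + B)) (b := B / (A + B)) (by positivity) (by positivity)
      (by field_simp)
    have e : (A / (A + B)) • (r / A) • x + (B / (A + B)) • (r / B) • y =
        (r / (A + B)) • (x + y) := by
      rw [smul_smul, smul_smul, smul_add]
      congr 2 <;> field_simp
    rw [e, mem_ofPred_eq, hom _ _ (by positivity), div_mul_eq_mul_div,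
      div_le_iff₀ (by positivity)] at h
    have := le_of_mul_le_mul_left h hr
    simp only [A, B] at this
    linarith
  refine ⟨convex_univ, fun x _ y _ a b ha hb _ => ?_⟩
  calc Φ (a • x + b • y) ≤ Φ (a • x) + Φ (b • y) := hadd _ _
    _ = a • Φ x + b • Φ y := by rw [hom _ _ ha, hom _ _ hb, smul_eq_mul, smul_eq_mul]

/-! ### Orthogonally invariant functions of symmetric matrices -/

section Spectral

variable {n : Type*} [Fintype n] [DecidableEq n]

theorem sq_mem_doublyStochastic {U : Matrix n n ℝ} (hU : U ∈ orthogonalGroup n ℝ) :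
    (of fun i j => U i j ^ 2) ∈ doublyStochastic ℝ n := by
  rw [mem_doublyStochastic_iff_sum]
  refine ⟨fun i j => sq_nonneg _, fun i => ?_, fun j => ?_⟩
  · have := congrFun (congrFun ((mem_orthogonalGroup_iff _ _).1 hU) i) i
    simpa [mul_apply, sq] using this
  · have := congrFun (congrFun ((mem_orthogonalGroup_iff' _ _).1 hU) j) j
    simpa [mul_apply, sq] using this

theorem diag_conj_diagonal (U : Matrix n n ℝ) (s : n → ℝ) :
    (U * diagonal s * Uᵀ).diag = (of fun i j => U i j ^ 2) *ᵥ s := by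
  ext i
  rw [diag_apply, mul_apply]
  simp only [mul_diagonal, transpose_apply, mulVec, dotProduct, of_apply]
  exact Finset.sum_congr rfl fun j _ => by ring

theorem Matrix.IsSymm.exists_orthogonal_diagonalization {A : Matrix n n ℝ} (hA : A.IsSymm) :
    ∃ U ∈ orthogonalGroup n ℝ, ∃ s : n → ℝ, A = U * diagonal s * Uᵀ := by
  have hH : A.IsHermitian := by
    rw [IsHermitian, conjTranspose_eq_transpose_of_trivial, hA.eq]
  refine ⟨hH.eigenvectorUnitary, hH.eigenvectorUnitary.2, hH.eigenvalues, ?_⟩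
  have := hH.spectral_theorem
  rw [Unitary.conjStarAlgAut_apply] at this
  simpa [star_eq_conjTranspose, conjTranspose_eq_transpose_of_trivial, Function.comp_def] using this

theorem Matrix.transpose_mem_orthogonalGroup {U : Matrix n n ℝ} (hU : U ∈ orthogonalGroup n ℝ) :
    Uᵀ ∈ orthogonalGroup n ℝ := by
  have := Unitary.star_mem hU
  rwa [star_eq_conjTranspose, conjTranspose_eq_transpose_of_trivial] at this

theorem permMatrix_mem_orthogonalGroup (π : Equiv.Perm n) :
    π.permMatrix ℝ ∈ orthogonalGroup n ℝ := by
  rw [mem_orthogonalGroup_iff, transpose_permMatrix, ← permMatrix_mul]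
  simp

theorem diagonal_comp_perm (π : Equiv.Perm n) (s : n → ℝ) :
    diagonal (π.permMatrix ℝ *ᵥ s) = π.permMatrix ℝ * diagonal s * (π.permMatrix ℝ)ᵀ := by
  ext i j
  rw [mul_assoc, ← conjTranspose_eq_transpose_of_trivial]
  simp [permMatrix_mulVec, Equiv.Perm.permMatrix, PEquiv.toMatrix_toPEquiv_mul, diagonal_apply]

/-- An orthogonally invariant function on the symmetric matrices is convex as soon as its
restriction to the diagonal matrices is. -/
theorem convexOn_isSymm_of_convexOn_diagonal {G : Matrix n n ℝ → ℝ}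
    (hG : ∀ U ∈ orthogonalGroup n ℝ, ∀ A, G (U * A * Uᵀ) = G A)
    (hdiag : ConvexOn ℝ univ fun s : n → ℝ => G (diagonal s)) :
    ConvexOn ℝ {A : Matrix n n ℝ | A.IsSymm} G := by
  have hperm : ∀ (π : Equiv.Perm n) s, G (diagonal (π.permMatrix ℝ *ᵥ s)) = G (diagonal s) :=
    fun π s => by rw [diagonal_comp_perm, hG _ (permMatrix_mem_orthogonalGroup π)]
  -- By Birkhoff, `M *ᵥ s` is a convex combination of permutations of `s`, on all of which `G` takes
  -- the same value.
  have hstoch : ∀ M ∈ doublyStochastic ℝ n, ∀ s : n → ℝ,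
      G (diagonal (M *ᵥ s)) ≤ G (diagonal s) := by
    intro M hM s
    obtain ⟨w, hw, hw1, rfl⟩ := exists_eq_sum_perm_of_mem_doublyStochastic hM
    have := hdiag.map_sum_le (t := Finset.univ) (w := w) (p := fun π => π.permMatrix ℝ *ᵥ s)
      (fun i _ => hw i) hw1 (fun _ _ => mem_univ _)
    simp only [hperm] at this
    rw [sum_mulVec]
    simp only [smul_mulVec]
    refine this.trans_eq ?_
    rw [← Finset.sum_smul, hw1, one_smul]
  have hschur : ∀ A : Matrix n n ℝ, A.IsSymm → G (diagonal A.diag) ≤ G A := by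
    intro A hA
    obtain ⟨U, hU, s, rfl⟩ := hA.exists_orthogonal_diagonalization
    rw [diag_conj_diagonal, hG U hU]
    exact hstoch _ (sq_mem_doublyStochastic hU) s
  have hconvex : Convex ℝ {A : Matrix n n ℝ | A.IsSymm} := by
    intro A hA B hB a b _ _ _
    exact (IsSymm.smul hA a).add (IsSymm.smul hB b)
  refine ⟨hconvex, fun A hA B hB a b ha hb hab => ?_⟩
  -- In an eigenbasis of the combination, its eigenvalue vector is the same combination of the
  -- diagonals of the rotated `A` and `B`; taking diagonals does not increase `G`.
  obtain ⟨U, hU, s, hs⟩ := (hconvex hA hB ha hb hab).exists_orthogonal_diagonalization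
  have hUt := transpose_mem_orthogonalGroup hU
  have hs' : s = a • (Uᵀ * A * U).diag + b • (Uᵀ * B * U).diag := by
    have : Uᵀ * (a • A + b • B) * U = diagonal s := by
      rw [hs]
      calc Uᵀ * (U * diagonal s * Uᵀ) * U = (Uᵀ * U) * diagonal s * (Uᵀ * U) := by noncomm_ring
        _ = diagonal s := by rw [(mem_orthogonalGroup_iff' _ _).1 hU, one_mul, mul_one]
    rw [← diag_diagonal s, ← this, ← diag_smul, ← diag_smul, ← diag_add]
    congr 1
    simp [Matrix.mul_add, Matrix.add_mul]
  have hbound : ∀ C : Matrix n n ℝ, C.IsSymm → G (diagonal (Uᵀ * C * U).diag) ≤ G C := by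
    intro C hC
    have h := hG _ hUt C
    rw [transpose_transpose] at h
    rw [← h]
    refine hschur _ ?_
    rw [IsSymm, transpose_mul, transpose_mul, transpose_transpose, hC.eq, mul_assoc]
  calc G (a • A + b • B) = G (diagonal s) := by rw [hs, hG U hU]
    _ ≤ a • G (diagonal (Uᵀ * A * U).diag) + b • G (diagonal (Uᵀ * B * U).diag) := by
        rw [hs']
        exact hdiag.2 (mem_univ _) (mem_univ _) ha hb hab
    _ ≤ a • G A + b • G B := by
        gcongr
        · exact hbound A hA
        · exact hbound B hB

end Spectral

end

/-! ### Stress invariants and the deviatoric plane -/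

noncomputable section

open Set Filter Topology Matrix

namespace YieldFunction

/-- The part `q / g(θ)` of the yield function. -/
def deviatoricGauge (g : ℝ → ℝ) (σ : Tensor) : ℝ := qInv σ / g (thetaInv σ)

/-- The deviatoric gauge in the coordinates of the deviatoric plane. -/
def planeGauge (g : ℝ → ℝ) (z : ℂ) : ℝ :=
  ‖z‖ / g ((1 / 3) * Real.arccos ((z ^ 3).re / ‖z‖ ^ 3))

/-- Projection of the principal stresses onto the deviatoric plane. -/
def toPlane : (Fin 3 → ℝ) →ₗ[ℝ] ℂ where
  toFun s := ⟨s 0 - (s 1 + s 2) / 2, Real.sqrt 3 / 2 * (s 1 - s 2)⟩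
  map_add' s t := by apply Complex.ext <;> simp <;> ring
  map_smul' c s := by apply Complex.ext <;> simp <;> ring

/-- The principal stresses of zero mean with given projection onto the deviatoric plane. -/
def ofPlane : ℂ →ₗ[ℝ] (Fin 3 → ℝ) where
  toFun z := ![2 / 3 * z.re, -z.re / 3 + z.im / Real.sqrt 3, -z.re / 3 - z.im / Real.sqrt 3]
  map_add' s t := by ext i; fin_cases i <;> simp <;> ring
  map_smul' c s := by ext i; fin_cases i <;> simp <;> ring

theorem toPlane_ofPlane (z : ℂ) : toPlane (ofPlane z) = z := by
  have h3 : Real.sqrt 3 ≠ 0 := by positivity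
  apply Complex.ext
  · simp [toPlane, ofPlane]; ring
  · simp [toPlane, ofPlane]; field_simp; ring

theorem pInv_diagonal (s : Fin 3 → ℝ) :
    pInv (diagonal s) = -(s 0 + s 1 + s 2) / 3 := by
  simp [pInv, Fin.sum_univ_three]

theorem pInv_diagonal_const (p : ℝ) : pInv (diagonal fun _ => -p) = p := by
  rw [pInv_diagonal]; ring

theorem dev_diagonal (s : Fin 3 → ℝ) :
    dev (diagonal s) = diagonal fun i => s i - (s 0 + s 1 + s 2) / 3 := by
  rw [dev, trace_diagonal, Fin.sum_univ_three, smul_one_eq_diagonal, diagonal_sub]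

theorem norm_toPlane_sq (s : Fin 3 → ℝ) : ‖toPlane s‖ ^ 2 = 3 * J2 (diagonal s) := by
  have h3 : Real.sqrt 3 ^ 2 = 3 := Real.sq_sqrt (by norm_num)
  rw [← Complex.normSq_eq_norm_sq, Complex.normSq_apply, J2, dev_diagonal, diagonal_pow,
    trace_diagonal, Fin.sum_univ_three]
  simp only [toPlane, LinearMap.coe_mk, AddHom.coe_mk, Pi.pow_apply]
  linear_combination (1 / 4) * (s 1 - s 2) ^ 2 * h3

/-- With `‖toPlane s‖ = q`, this identifies the argument of `arccos` in the Lode angle with the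
cosine of three times the polar angle. -/
theorem re_toPlane_pow_three (s : Fin 3 → ℝ) :
    (toPlane s ^ 3).re = 27 / 2 * J3 (diagonal s) := by
  have h3 : Real.sqrt 3 ^ 2 = 3 := Real.sq_sqrt (by norm_num)
  have hre : ∀ z : ℂ, (z ^ 3).re = z.re ^ 3 - 3 * z.re * z.im ^ 2 := by
    intro z; simp [pow_succ]; ring
  rw [hre, J3, dev_diagonal, diagonal_pow, trace_diagonal, Fin.sum_univ_three]
  simp only [toPlane, LinearMap.coe_mk, AddHom.coe_mk, Pi.pow_apply]
  linear_combination (-3 / 4) * (s 0 - (s 1 + s 2) / 2) * (s 1 - s 2) ^ 2 * h3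

/-- The hydrostatic axis needs no separate case: both arguments of `arccos` are then quotients by
zero, hence `0`. -/
theorem deviatoricGauge_diagonal (g : ℝ → ℝ) (s : Fin 3 → ℝ) :
    deviatoricGauge g (diagonal s) = planeGauge g (toPlane s) := by
  have hn := norm_toPlane_sq s
  have hJ : J2 (diagonal s) = ‖toPlane s‖ ^ 2 / 3 := by linarith
  have hq : qInv (diagonal s) = ‖toPlane s‖ := by
    rw [qInv, ← hn, Real.sqrt_sq (norm_nonneg _)]
  have h3 : Real.sqrt 3 ^ 2 = 3 := Real.sq_sqrt (by norm_num)
  have h3' : Real.sqrt 3 ≠ 0 := by positivity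
  have hpow : J2 (diagonal s) ^ (3 / 2 : ℝ) = ‖toPlane s‖ ^ 3 / (3 * Real.sqrt 3) := by
    have e : J2 (diagonal s) = (‖toPlane s‖ / Real.sqrt 3) ^ 2 := by rw [hJ, div_pow, h3]
    rw [e, ← Real.rpow_natCast, ← Real.rpow_mul (by positivity)]
    norm_num
    rw [div_pow]
    congr 1
    rw [pow_succ, h3]
  have hθ : thetaInv (diagonal s) =
      (1 / 3) * Real.arccos ((toPlane s ^ 3).re / ‖toPlane s‖ ^ 3) := by
    rw [thetaInv, hpow, re_toPlane_pow_three]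
    congr 2
    rw [div_div_eq_mul_div, ← mul_div_assoc]
    congr 1
    linear_combination (9 / 2) * J3 (diagonal s) * h3
  rw [deviatoricGauge, planeGauge, hq, hθ]

theorem yieldFun_eq (f g : ℝ → ℝ) (σ : Tensor) :
    yieldFun f g σ = f (pInv σ) + deviatoricGauge g σ := rfl

theorem trace_conj {U : Tensor} (hU : U ∈ orthogonalGroup (Fin 3) ℝ) (σ : Tensor) :
    (U * σ * Uᵀ).trace = σ.trace := by
  rw [trace_mul_comm, ← mul_assoc, (mem_orthogonalGroup_iff' _ _).1 hU, one_mul]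

theorem dev_conj {U : Tensor} (hU : U ∈ orthogonalGroup (Fin 3) ℝ) (σ : Tensor) :
    dev (U * σ * Uᵀ) = U * dev σ * Uᵀ := by
  rw [dev, dev, trace_conj hU, Matrix.mul_sub, Matrix.sub_mul]
  simp [(mem_orthogonalGroup_iff _ _).1 hU]

theorem conj_pow {U : Tensor} (hU : U ∈ orthogonalGroup (Fin 3) ℝ) (σ : Tensor)
    (k : ℕ) : (U * σ * Uᵀ) ^ k = U * σ ^ k * Uᵀ := by
  induction k with
  | zero => simp [(mem_orthogonalGroup_iff _ _).1 hU]
  | succ k ih =>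
    calc (U * σ * Uᵀ) ^ (k + 1) = U * σ ^ k * (Uᵀ * U) * σ * Uᵀ := by
          rw [pow_succ, ih]; simp only [mul_assoc]
      _ = U * σ ^ (k + 1) * Uᵀ := by
          rw [(mem_orthogonalGroup_iff' _ _).1 hU, mul_one, pow_succ]; simp only [mul_assoc]

theorem deviatoricGauge_conj {U : Tensor} (hU : U ∈ orthogonalGroup (Fin 3) ℝ) (σ : Tensor)
    (g : ℝ → ℝ) :
    deviatoricGauge g (U * σ * Uᵀ) = deviatoricGauge g σ := by
  simp only [deviatoricGauge, qInv, thetaInv, J2, J3, dev_conj hU, conj_pow hU, trace_conj hU]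

theorem convexOn_deviatoricGauge {g : ℝ → ℝ} (h : ConvexOn ℝ univ (planeGauge g)) :
    ConvexOn ℝ {σ : Tensor | σ.IsSymm} (deviatoricGauge g) := by
  refine convexOn_isSymm_of_convexOn_diagonal (fun U hU A => deviatoricGauge_conj hU A g) ?_
  simp only [deviatoricGauge_diagonal]
  exact h.comp_linearMap toPlane

theorem pInv_add_smul (a b : ℝ) (σ τ : Tensor) :
    pInv (a • σ + b • τ) = a * pInv σ + b * pInv τ := by
  simp [pInv]; ring

theorem convex_domain {D : Set ℝ} (hD : Convex ℝ D) : Convex ℝ (domain D) := by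
  intro σ hσ τ hτ a b ha hb hab
  refine ⟨(hσ.1.smul a).add (hτ.1.smul b), ?_⟩
  rw [pInv_add_smul]
  exact hD hσ.2 hτ.2 ha hb hab

theorem planeGauge_zero (g : ℝ → ℝ) : planeGauge g 0 = 0 := by simp [planeGauge]

theorem deviatoricGauge_diagonal_const (g : ℝ → ℝ) (p : ℝ) :
    deviatoricGauge g (diagonal fun _ => p) = 0 := by
  have : toPlane (fun _ => p) = 0 := by
    apply Complex.ext <;> simp [toPlane]
  rw [deviatoricGauge_diagonal, this, planeGauge_zero]

/-- The principal stresses with mean pressure `p` and projection `z` onto the deviatoric plane. -/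
def principal (p : ℝ) (z : ℂ) : Fin 3 → ℝ := fun i => -p + ofPlane z i

theorem toPlane_principal (p : ℝ) (z : ℂ) : toPlane (principal p z) = z := by
  have : principal p z = (fun _ => -p) + ofPlane z := rfl
  rw [this, map_add, toPlane_ofPlane]
  apply Complex.ext <;> simp [toPlane]

theorem pInv_principal (p : ℝ) (z : ℂ) : pInv (diagonal (principal p z)) = p := by
  rw [pInv_diagonal]; simp [principal, ofPlane]; ring

theorem principal_combo (p : ℝ) (z w : ℂ) {a b : ℝ} (hab : a + b = 1) :
    principal p (a • z + b • w) = a • principal p z + b • principal p w := by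
  ext i
  simp only [principal, map_add, map_smul, Pi.add_apply, Pi.smul_apply, smul_eq_mul]
  linear_combination p * hab

theorem yieldFun_principal (f g : ℝ → ℝ) (p : ℝ) (z : ℂ) :
    yieldFun f g (diagonal (principal p z)) = f p + planeGauge g z := by
  rw [yieldFun_eq, deviatoricGauge_diagonal, toPlane_principal, pInv_principal]

theorem yieldFun_hydrostatic (f g : ℝ → ℝ) (p : ℝ) :
    yieldFun f g (diagonal fun _ => -p) = f p := by
  rw [yieldFun_eq, deviatoricGauge_diagonal_const, pInv_diagonal_const, add_zero]

/-- The gauge vanishes on hydrostatic stresses, so `F` restricts there to `f`; on stresses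
`principal p z` with `p` fixed it is the gauge plus a constant. Conversely, a sum of convex
functions is convex. -/
theorem convexOn_yieldFun_iff {D : Set ℝ} (hD : Convex ℝ D) (hDne : D.Nonempty) (f g : ℝ → ℝ) :
    ConvexOn ℝ (domain D) (yieldFun f g) ↔ ConvexOn ℝ D f ∧ ConvexOn ℝ univ (planeGauge g) := by
  constructor
  · intro hF
    refine ⟨⟨hD, fun x hx y hy a b ha hb hab => ?_⟩, convex_univ, fun z _ w _ a b ha hb hab => ?_⟩
    · have hmem : ∀ p ∈ D, (diagonal fun _ => -p : Tensor) ∈ domain D := fun p hp =>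
        ⟨isSymm_diagonal _, by rwa [pInv_diagonal_const]⟩
      have h := hF.2 (hmem x hx) (hmem y hy) ha hb hab
      have e : a • (diagonal fun _ => -x : Tensor) + b • (diagonal fun _ => -y : Tensor) =
          (diagonal fun _ => -(a • x + b • y) : Tensor) := by
        rw [← diagonal_smul, ← diagonal_smul, diagonal_add]
        congr 1; ext i; simp; ring
      rwa [e, yieldFun_hydrostatic, yieldFun_hydrostatic, yieldFun_hydrostatic] at h
    · obtain ⟨p, hp⟩ := hDne
      have hmem : ∀ z, diagonal (principal p z) ∈ domain D := fun z =>
        ⟨isSymm_diagonal _, by rwa [pInv_principal]⟩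
      have h := hF.2 (hmem z) (hmem w) ha hb hab
      have e : a • diagonal (principal p z) + b • diagonal (principal p w) =
          diagonal (principal p (a • z + b • w)) := by
        rw [← diagonal_smul, ← diagonal_smul, diagonal_add, principal_combo p z w hab]; rfl
      rw [e, yieldFun_principal, yieldFun_principal, yieldFun_principal] at h
      simp only [smul_eq_mul] at h ⊢
      linear_combination h + (f p) * hab
  · rintro ⟨hf, hg⟩
    have hG := convexOn_deviatoricGauge hg
    refine ⟨convex_domain hD, fun σ hσ τ hτ a b ha hb hab => ?_⟩
    have h₁ := hf.2 hσ.2 hτ.2 ha hb hab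
    have h₂ := hG.2 hσ.1 hτ.1 ha hb hab
    simp only [yieldFun_eq, pInv_add_smul, smul_eq_mul] at *
    linarith

theorem planeGauge_smul (g : ℝ → ℝ) {c : ℝ} (hc : 0 ≤ c) (z : ℂ) :
    planeGauge g (c • z) = c * planeGauge g z := by
  rcases hc.eq_or_lt with rfl | hc
  · simp [planeGauge_zero]
  · have : ((c • z) ^ 3).re / ‖c • z‖ ^ 3 = (z ^ 3).re / ‖z‖ ^ 3 := by
      rw [smul_pow, Complex.smul_re, norm_smul, mul_pow, Real.norm_of_nonneg hc.le, smul_eq_mul,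
        mul_div_mul_left _ _ (by positivity)]
    rw [planeGauge, planeGauge, this, norm_smul, Real.norm_of_nonneg hc.le, mul_div_assoc]

theorem third_arccos_mem (x : ℝ) : (1 / 3) * Real.arccos x ∈ Icc 0 (Real.pi / 3) := by
  constructor <;> linarith [Real.arccos_nonneg x, Real.arccos_le_pi x]

theorem planeGauge_nonneg {g : ℝ → ℝ} (hg : ∀ θ ∈ Icc 0 (Real.pi / 3), 0 < g θ) (z : ℂ) :
    0 ≤ planeGauge g z :=
  div_nonneg (norm_nonneg _) (hg _ (third_arccos_mem _)).le

/-! ### Meridian and deviatoric sections -/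

theorem convex_meridianSection {D : Set ℝ} {f g : ℝ → ℝ} (hf : ConvexOn ℝ D f) (θ : ℝ) :
    Convex ℝ (meridianSection D f g θ) := by
  rintro ⟨p, q⟩ ⟨hp, hq, h⟩ ⟨p', q'⟩ ⟨hp', hq', h'⟩ a b ha hb hab
  refine ⟨hf.1 hp hp' ha hb hab, ?_, ?_⟩
  · simp only [Prod.snd_add, Prod.smul_snd, smul_eq_mul] at *
    positivity
  · have := hf.2 hp hp' ha hb hab
    simp only [Prod.fst_add, Prod.smul_fst, Prod.snd_add, Prod.smul_snd, smul_eq_mul] at *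
    rw [add_div, mul_div_assoc, mul_div_assoc]
    nlinarith [mul_le_mul_of_nonneg_left h ha, mul_le_mul_of_nonneg_left h' hb]

theorem convex_deviatoricSection {D : Set ℝ} {f g : ℝ → ℝ}
    (hF : ConvexOn ℝ (domain D) (yieldFun f g)) {p : ℝ} (hp : p ∈ D) :
    Convex ℝ (deviatoricSection f g p) := by
  rintro s ⟨hs, hs'⟩ t ⟨ht, ht'⟩ a b ha hb hab
  have e : diagonal (a • s + b • t) = a • diagonal s + b • diagonal t := by
    rw [← diagonal_smul, ← diagonal_smul, diagonal_add]; rfl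
  have h := hF.2 (x := diagonal s) (y := diagonal t) ⟨isSymm_diagonal _, by rwa [hs]⟩
    ⟨isSymm_diagonal _, by rwa [ht]⟩ ha hb hab
  refine ⟨?_, ?_⟩
  · rw [e, pInv_add_smul, hs, ht, ← add_mul, hab, one_mul]
  · rw [e]
    simp only [smul_eq_mul] at h
    nlinarith [mul_nonpos_of_nonneg_of_nonpos ha hs', mul_nonpos_of_nonneg_of_nonpos hb ht']

/-- The boundary points `(p, -g(θ) f(p))` belong to the region because `f ≤ 0`; that their
combinations stay in it is the convexity inequality for `f`. -/
theorem convexOn_of_convex_meridianSection {D : Set ℝ} (hD : Convex ℝ D) {f g : ℝ → ℝ}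
    (hf : ∀ p ∈ D, f p ≤ 0) {θ : ℝ} (hθ : 0 < g θ) (h : Convex ℝ (meridianSection D f g θ)) :
    ConvexOn ℝ D f := by
  refine ⟨hD, fun x hx y hy a b ha hb hab => ?_⟩
  have hmem : ∀ p ∈ D, (p, g θ * -f p) ∈ meridianSection D f g θ := fun p hp =>
    ⟨hp, mul_nonneg hθ.le (by linarith [hf p hp]), by
      rw [mul_div_cancel_left₀ _ hθ.ne', add_neg_cancel]⟩
  have := (h (hmem x hx) (hmem y hy) ha hb hab).2.2
  simp only [Prod.fst_add, Prod.smul_fst, Prod.snd_add, Prod.smul_snd, smul_eq_mul] at this ⊢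
  have e : (a * (g θ * -f x) + b * (g θ * -f y)) / g θ = -(a * f x + b * f y) := by
    field_simp; ring
  linarith

/-- The section at `p` is a copy of the sublevel set of the gauge at the positive level `-f p`. -/
theorem convexOn_planeGauge_of_convex_deviatoricSection {f g : ℝ → ℝ}
    (hg : ∀ θ ∈ Icc 0 (Real.pi / 3), 0 < g θ) {p : ℝ} (hp : f p < 0)
    (h : Convex ℝ (deviatoricSection f g p)) : ConvexOn ℝ univ (planeGauge g) := by
  refine convexOn_of_convex_sublevel (planeGauge_nonneg hg) (fun c z hc => planeGauge_smul g hc z)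
    (neg_pos.2 hp) ?_
  have hiff : ∀ z, planeGauge g z ≤ -f p ↔ principal p z ∈ deviatoricSection f g p := by
    intro z
    refine Iff.trans ?_ (and_iff_right (pInv_principal p z)).symm
    rw [yieldFun_principal]
    constructor <;> intro <;> linarith
  intro z hz w hw a b ha hb hab
  refine (hiff _).2 ?_
  rw [principal_combo p z w hab]
  exact h ((hiff z).1 hz) ((hiff w).1 hw) ha hb hab

theorem convexOn_yieldFun_iff_sections {D : Set ℝ} (hD : Convex ℝ D) {f g : ℝ → ℝ}
    (hg : ∀ θ ∈ Icc 0 (Real.pi / 3), 0 < g θ) (hf : ∀ p ∈ D, f p ≤ 0) (hf' : ∃ p ∈ D, f p < 0) :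
    ConvexOn ℝ (domain D) (yieldFun f g) ↔
      (∀ θ ∈ Icc 0 (Real.pi / 3), Convex ℝ (meridianSection D f g θ)) ∧
        ∀ p ∈ D, Convex ℝ (deviatoricSection f g p) := by
  obtain ⟨p, hp, hfp⟩ := hf'
  have hiff := convexOn_yieldFun_iff hD ⟨p, hp⟩ f g
  have h0 : (0 : ℝ) ∈ Icc 0 (Real.pi / 3) := ⟨le_rfl, by positivity⟩
  exact ⟨fun hF => ⟨fun θ _ => convex_meridianSection (hiff.1 hF).1 θ,
      fun _ hp => convex_deviatoricSection hF hp⟩,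
    fun h => hiff.2 ⟨convexOn_of_convex_meridianSection hD hf (hg 0 h0) (h.1 0 h0),
      convexOn_planeGauge_of_convex_deviatoricSection hg hfp (h.2 p hp)⟩⟩

end YieldFunction

end

/-! ### Tangent-line lifts and trigonometric supports -/

section

open Set Filter Topology

theorem hasDerivAt_sqrt_one_add_sq (t : ℝ) :
    HasDerivAt (fun t : ℝ => Real.sqrt (1 + t ^ 2)) (t / Real.sqrt (1 + t ^ 2)) t := by
  have hpos : 0 < 1 + t ^ 2 := by positivity
  refine ((((hasDerivAt_id t).pow 2).const_add 1).sqrt hpos.ne').congr_deriv ?_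
  simp; field_simp

/-- The lifted function is `r u(α)` at the point `e^{iθ}(1 + it)` of the tangent line, which has
modulus `√(1 + t²)` and argument `θ + arctan t`. -/
theorem hasDerivAt_tangent_lift {u : ℝ → ℝ} {d θ t : ℝ} (h : HasDerivAt u d (θ + Real.arctan t)) :
    HasDerivAt (fun t => Real.sqrt (1 + t ^ 2) * u (θ + Real.arctan t))
      ((t * u (θ + Real.arctan t) + d) / Real.sqrt (1 + t ^ 2)) t := by
  have hpos : 0 < 1 + t ^ 2 := by positivity
  have hs : Real.sqrt (1 + t ^ 2) ^ 2 = 1 + t ^ 2 := Real.sq_sqrt hpos.le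
  have hs0 : 0 < Real.sqrt (1 + t ^ 2) := Real.sqrt_pos.2 hpos
  have h1 := hasDerivAt_sqrt_one_add_sq t
  have h2 : HasDerivAt (fun t => u (θ + Real.arctan t)) (d * (1 / (1 + t ^ 2))) t :=
    h.comp t ((Real.hasDerivAt_arctan t).const_add θ)
  refine (h1.mul h2).congr_deriv ?_
  generalize Real.sqrt (1 + t ^ 2) = r at hs hs0
  rw [← hs]
  field_simp

theorem hasDerivAt_deriv_tangent_lift {u u' : ℝ → ℝ} {d θ t : ℝ}
    (h : HasDerivAt u (u' (θ + Real.arctan t)) (θ + Real.arctan t))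
    (h' : HasDerivAt u' d (θ + Real.arctan t)) :
    HasDerivAt
      (fun t => (t * u (θ + Real.arctan t) + u' (θ + Real.arctan t)) / Real.sqrt (1 + t ^ 2))
      ((u (θ + Real.arctan t) + d) / Real.sqrt (1 + t ^ 2) ^ 3) t := by
  have hpos : 0 < 1 + t ^ 2 := by positivity
  have hs : Real.sqrt (1 + t ^ 2) ^ 2 = 1 + t ^ 2 := Real.sq_sqrt hpos.le
  have hs0 : 0 < Real.sqrt (1 + t ^ 2) := Real.sqrt_pos.2 hpos
  have h1 := hasDerivAt_sqrt_one_add_sq t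
  have h2 : HasDerivAt (fun t => u (θ + Real.arctan t))
      (u' (θ + Real.arctan t) * (1 / (1 + t ^ 2))) t :=
    h.comp t ((Real.hasDerivAt_arctan t).const_add θ)
  have h3 : HasDerivAt (fun t => u' (θ + Real.arctan t)) (d * (1 / (1 + t ^ 2))) t :=
    h'.comp t ((Real.hasDerivAt_arctan t).const_add θ)
  refine ((((hasDerivAt_id t).mul h2).add h3).div h1 hs0.ne').congr_deriv ?_
  simp only [id, Pi.mul_apply, Pi.add_apply]
  generalize u (θ + Real.arctan t) = a
  generalize u' (θ + Real.arctan t) = b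
  generalize Real.sqrt (1 + t ^ 2) = r at hs hs0
  rw [← hs]
  field_simp
  rw [hs]
  ring

/-- A solution of `u + u'' ≥ 0` lies above the trigonometric function with the same value and
the same right derivative at the left end point. -/
theorem trig_support_right {u u' u'' : ℝ → ℝ} {θ b d : ℝ} (hb : b < θ + Real.pi / 2)
    (hd : HasDerivWithinAt u d (Ici θ) θ)
    (hu : ∀ x ∈ Ioo θ b, HasDerivAt u (u' x) x) (hu' : ∀ x ∈ Ioo θ b, HasDerivAt u' (u'' x) x)
    (hpos : ∀ x ∈ Ioo θ b, 0 ≤ u x + u'' x) {φ : ℝ} (hφ : φ ∈ Ioo 0 (b - θ)) :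
    u θ * Real.cos φ + d * Real.sin φ ≤ u (θ + φ) := by
  have hε : 0 < b - θ := hφ.1.trans hφ.2
  have hε2 : b - θ < Real.pi / 2 := by linarith
  have harc : ∀ t ∈ Ioo 0 (Real.tan (b - θ)), θ + Real.arctan t ∈ Ioo θ b := by
    intro t ht
    have h1 := Real.arctan_strictMono ht.1
    have h2 := Real.arctan_strictMono ht.2
    rw [Real.arctan_tan (by linarith) hε2] at h2
    rw [Real.arctan_zero] at h1
    constructor <;> linarith
  set k : ℝ → ℝ := fun t => Real.sqrt (1 + t ^ 2) * u (θ + Real.arctan t) with hk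
  have hk0 : HasDerivWithinAt k d (Ici 0) 0 := by
    have h1 : HasDerivWithinAt (fun t : ℝ => Real.sqrt (1 + t ^ 2)) 0 (Ici 0) 0 := by
      have := (((hasDerivAt_id (0 : ℝ)).pow 2).const_add 1).sqrt (by simp)
      exact (this.congr_deriv (by simp)).hasDerivWithinAt
    have h2 : HasDerivWithinAt (fun t => θ + Real.arctan t) 1 (Ici 0) 0 := by
      have := (Real.hasDerivAt_arctan 0).const_add θ
      exact (this.congr_deriv (by simp)).hasDerivWithinAt
    have hd' : HasDerivWithinAt u d (Ici θ) (θ + Real.arctan 0) := by simpa using hd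
    have h3 := hd'.comp (0 : ℝ) h2 (fun t ht => by
      have := Real.arctan_nonneg.2 ht
      simp only [mem_Ici]; linarith)
    exact (h1.mul h3).congr_deriv (by simp)
  have hkd : ∀ t ∈ Ioo 0 (Real.tan (b - θ)), HasDerivAt k
      ((t * u (θ + Real.arctan t) + u' (θ + Real.arctan t)) / Real.sqrt (1 + t ^ 2)) t :=
    fun t ht => hasDerivAt_tangent_lift (hu _ (harc t ht))
  -- The end point `0` is included although only a one-sided derivative exists there: continuity
  -- suffices to extend convexity to it.
  have hconv : ConvexOn ℝ (Ico 0 (Real.tan (b - θ))) k := by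
    refine convexOn_of_hasDerivWithinAt2_nonneg (convex_Ico _ _) ?_
      (f' := fun t => (t * u (θ + Real.arctan t) + u' (θ + Real.arctan t)) / Real.sqrt (1 + t ^ 2))
      (f'' := fun t => (u (θ + Real.arctan t) + u'' (θ + Real.arctan t)) /
        Real.sqrt (1 + t ^ 2) ^ 3) ?_ ?_ ?_
    · intro t ht
      rcases ht.1.eq_or_lt with rfl | h0
      · exact hk0.continuousWithinAt.mono Ico_subset_Ici_self
      · exact (hkd t ⟨h0, ht.2⟩).continuousAt.continuousWithinAt
    all_goals rw [interior_Ico]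
    · exact fun t ht => (hkd t ht).hasDerivWithinAt
    · exact fun t ht =>
        (hasDerivAt_deriv_tangent_lift (hu _ (harc t ht)) (hu' _ (harc t ht))).hasDerivWithinAt
    · exact fun t ht => div_nonneg (hpos _ (harc t ht)) (by positivity)
  have hcos : 0 < Real.cos φ :=
    Real.cos_pos_of_mem_Ioo ⟨by linarith [hφ.1], by linarith [hφ.2]⟩
  have htan : 0 < Real.tan φ := Real.tan_pos_of_pos_of_lt_pi_div_two hφ.1 (by linarith [hφ.2])
  have htan' : Real.tan φ < Real.tan (b - θ) :=
    Real.tan_lt_tan_of_nonneg_of_lt_pi_div_two hφ.1.le hε2 hφ.2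
  -- Convexity gives `k(0) + d tan φ ≤ k(tan φ) = u(θ + φ) / cos φ`; multiplying by `cos φ` yields
  -- the claim.
  have hsl := hconv.le_slope_of_hasDerivWithinAt_Ioi (x := 0) (y := Real.tan φ)
    ⟨le_rfl, htan.trans htan'⟩ ⟨htan.le, htan'⟩ htan (hk0.mono Ioi_subset_Ici_self)
  rw [slope_def_field, sub_zero, le_div_iff₀ htan] at hsl
  have hsqrt : Real.sqrt (1 + Real.tan φ ^ 2) = (Real.cos φ)⁻¹ := by
    rw [← inv_inv (Real.sqrt _), Real.inv_sqrt_one_add_tan_sq hcos]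
  have hkφ : k (Real.tan φ) = (Real.cos φ)⁻¹ * u (θ + φ) := by
    simp only [hk]
    rw [hsqrt, Real.arctan_tan (by linarith [hφ.1]) (by linarith [hφ.2])]
  have hk00 : k 0 = u θ := by simp [hk]
  rw [hkφ, hk00, Real.tan_eq_sin_div_cos] at hsl
  have := mul_le_mul_of_nonneg_right hsl hcos.le
  field_simp at this
  linarith

theorem hasDerivAt_of_left_right {f : ℝ → ℝ} {d x : ℝ} (hl : HasDerivWithinAt f d (Iio x) x)
    (hr : HasDerivWithinAt f d (Ioi x) x) : HasDerivAt f d x := by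
  have := (hasDerivWithinAt_Iio_iff_Iic.1 hl).union (hasDerivWithinAt_Ioi_iff_Ici.1 hr)
  rwa [Iic_union_Ici, hasDerivWithinAt_univ] at this

/-- Reciprocals: `g² + 2 g'² - g g'' ≥ 0` means `u + u'' ≥ 0` for `u = 1 / g`. -/
theorem hasDerivAt_deriv_inv {g : ℝ → ℝ} {x : ℝ} (h0 : g x ≠ 0) (hg : DifferentiableAt ℝ g x)
    (hg' : DifferentiableAt ℝ (deriv g) x) :
    HasDerivAt (fun y => -deriv g y / g y ^ 2)
      ((2 * deriv g x ^ 2 - g x * deriv (deriv g) x) / g x ^ 3) x := by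
  refine (hg'.hasDerivAt.neg.div (hg.hasDerivAt.pow 2) (pow_ne_zero 2 h0)).congr_deriv ?_
  simp
  field_simp
  ring

theorem trig_support_inv_right {g : ℝ → ℝ} {θ b d : ℝ} (hθb : θ < b) (hb : b < θ + Real.pi / 2)
    (h0 : ∀ x ∈ Ico θ b, 0 < g x) (hd : HasDerivWithinAt g d (Ici θ) θ)
    (hg : ∀ x ∈ Ioo θ b, DifferentiableAt ℝ g x ∧ DifferentiableAt ℝ (deriv g) x)
    (hpos : ∀ x ∈ Ioo θ b, 0 ≤ g x ^ 2 + 2 * deriv g x ^ 2 - g x * deriv (deriv g) x)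
    {φ : ℝ} (hφ : φ ∈ Ioo 0 (b - θ)) :
    (g θ)⁻¹ * Real.cos φ + -d / g θ ^ 2 * Real.sin φ ≤ (g (θ + φ))⁻¹ := by
  refine trig_support_right (u := fun x => (g x)⁻¹) (u' := fun x => -deriv g x / g x ^ 2)
    (u'' := fun x => (2 * deriv g x ^ 2 - g x * deriv (deriv g) x) / g x ^ 3) hb
    (hd.fun_inv (h0 θ ⟨le_rfl, hθb⟩).ne') ?_ ?_ ?_ hφ
  · exact fun x hx => (hg x hx).1.hasDerivAt.fun_inv (h0 x (Ioo_subset_Ico_self hx)).ne'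
  · exact fun x hx => hasDerivAt_deriv_inv (h0 x (Ioo_subset_Ico_self hx)).ne' (hg x hx).1 (hg x hx).2
  · intro x hx
    have hgx := h0 x (Ioo_subset_Ico_self hx)
    have : (g x)⁻¹ + (2 * deriv g x ^ 2 - g x * deriv (deriv g) x) / g x ^ 3 =
        (g x ^ 2 + 2 * deriv g x ^ 2 - g x * deriv (deriv g) x) / g x ^ 3 := by
      field_simp; ring
    rw [this]
    exact div_nonneg (hpos x hx) (by positivity)

/-- The right-hand version applied to `x ↦ g(-x)`: the second-order expression is unchanged because
`g'` enters squared. -/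
theorem trig_support_inv_left {g : ℝ → ℝ} {θ b d : ℝ} (hθb : b < θ) (hb : θ - Real.pi / 2 < b)
    (h0 : ∀ x ∈ Ioc b θ, 0 < g x) (hd : HasDerivWithinAt g d (Iic θ) θ)
    (hg : ∀ x ∈ Ioo b θ, DifferentiableAt ℝ g x ∧ DifferentiableAt ℝ (deriv g) x)
    (hpos : ∀ x ∈ Ioo b θ, 0 ≤ g x ^ 2 + 2 * deriv g x ^ 2 - g x * deriv (deriv g) x)
    {φ : ℝ} (hφ : φ ∈ Ioo 0 (θ - b)) :
    (g θ)⁻¹ * Real.cos φ + d / g θ ^ 2 * Real.sin φ ≤ (g (θ - φ))⁻¹ := by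
  have hderiv : deriv (fun x => g (-x)) = fun x => -deriv g (-x) := by
    ext x; exact deriv_comp_neg g x
  have hmem : ∀ x ∈ Ioo (-θ) (-b), -x ∈ Ioo b θ := fun x hx =>
    ⟨by linarith [hx.2], by linarith [hx.1]⟩
  have key := trig_support_inv_right (g := fun x => g (-x)) (θ := -θ) (b := -b) (d := -d)
    (by linarith) (by linarith) (fun x hx => h0 _ ⟨by linarith [hx.2], by linarith [hx.1]⟩) ?_ ?_ ?_
    (φ := φ) ⟨hφ.1, by linarith [hφ.2]⟩
  · simpa [neg_add_rev, sub_eq_neg_add] using key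
  · have hd' : HasDerivWithinAt g d (Iic θ) (-(-θ)) := by simpa using hd
    have := hd'.comp (-θ) (hasDerivAt_neg (-θ)).hasDerivWithinAt
      (s := Ici (-θ)) (fun x hx => by simp only [mem_Ici, mem_Iic] at *; linarith)
    exact this.congr_deriv (by ring)
  · intro x hx
    refine ⟨differentiableAt_comp_neg.2 (hg _ (hmem x hx)).1, ?_⟩
    rw [hderiv]
    exact (differentiableAt_comp_neg.2 (hg _ (hmem x hx)).2).neg
  · intro x hx
    have h2 : deriv (fun x => -deriv g (-x)) x = deriv (deriv g) (-x) := by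
      rw [deriv.fun_neg, deriv_comp_neg, neg_neg]
    rw [hderiv, h2, neg_sq]
    exact hpos _ (hmem x hx)

end

/-! ### The polar profile and necessary conditions -/

noncomputable section

open Set Filter Topology

namespace YieldFunction

/-- The reciprocal of `g`, extended from `[0, π/3]` by reflections to all polar angles of the
deviatoric plane. -/
def polarProfile (g : ℝ → ℝ) (α : ℝ) : ℝ := (g ((1 / 3) * Real.arccos (Real.cos (3 * α))))⁻¹

variable {g : ℝ → ℝ}

theorem polarProfile_eq {α : ℝ} (h : α ∈ Icc 0 (Real.pi / 3)) : polarProfile g α = (g α)⁻¹ := by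
  rw [polarProfile, Real.arccos_cos (by linarith [h.1]) (by linarith [h.2])]
  congr 2; ring

theorem polarProfile_congr {α β : ℝ} (h : Real.cos (3 * α) = Real.cos (3 * β)) :
    polarProfile g α = polarProfile g β := by rw [polarProfile, h, polarProfile]

theorem polarProfile_neg (α : ℝ) : polarProfile g (-α) = polarProfile g α :=
  polarProfile_congr (by rw [mul_neg, Real.cos_neg])

theorem polarProfile_reflect (α : ℝ) :
    polarProfile g (2 * (Real.pi / 3) - α) = polarProfile g α :=
  polarProfile_congr (by
    rw [show 3 * (2 * (Real.pi / 3) - α) = 2 * Real.pi - 3 * α by ring, Real.cos_two_pi_sub])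

/-- The profile depends only on `cos 3α`, so a rotation by a multiple of `2π/3`, possibly with a
reflection, brings `α` into `[0, π/3]`. The two alternatives record whether orientation is kept. -/
theorem exists_polarProfile_reduction (α : ℝ) : ∃ θ ∈ Icc 0 (Real.pi / 3),
    (∀ (g : ℝ → ℝ) φ, polarProfile g (α + φ) = polarProfile g (θ + φ)) ∨
      ∀ (g : ℝ → ℝ) φ, polarProfile g (α + φ) = polarProfile g (θ - φ) := by
  refine ⟨_, third_arccos_mem (Real.cos (3 * α)), ?_⟩
  set θ := (1 / 3) * Real.arccos (Real.cos (3 * α)) with hθ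
  have hcos : Real.cos (3 * α) = Real.cos (3 * θ) := by
    rw [hθ, ← mul_assoc]
    norm_num
    rw [Real.cos_arccos (Real.neg_one_le_cos _) (Real.cos_le_one _)]
  obtain ⟨k, hk | hk⟩ := Real.cos_eq_cos_iff.1 hcos
  · left
    intro g φ
    refine polarProfile_congr ?_
    rw [mul_add, mul_add, hk, ← Real.cos_add_int_mul_two_pi (3 * α + 3 * φ) k]
    congr 1; ring
  · right
    intro g φ
    refine polarProfile_congr ?_
    rw [mul_sub, hk, ← Real.cos_neg (3 * (α + φ)),
      ← Real.cos_add_int_mul_two_pi (-(3 * (α + φ))) k]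
    congr 1; ring

theorem planeGauge_polar {r : ℝ} (hr : 0 ≤ r) (α : ℝ) :
    planeGauge g (r * Complex.exp (α * Complex.I)) = r * polarProfile g α := by
  rcases hr.eq_or_lt with rfl | hr'
  · simp [planeGauge_zero]
  have hn : ‖(r * Complex.exp (α * Complex.I) : ℂ)‖ = r := by
    rw [norm_mul, Complex.norm_exp_ofReal_mul_I, mul_one, Complex.norm_real,
      Real.norm_of_nonneg hr]
  have hre : ((r * Complex.exp (α * Complex.I) : ℂ) ^ 3).re = r ^ 3 * Real.cos (3 * α) := by
    rw [mul_pow, ← Complex.exp_nat_mul, ← Complex.ofReal_pow, Complex.re_ofReal_mul,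
      ← Complex.exp_ofReal_mul_I_re]
    congr 3
    push_cast; ring
  rw [planeGauge, hn, hre, mul_div_cancel_left₀ _ (by positivity), polarProfile, div_eq_mul_inv]

theorem planeGauge_mul (z w : ℂ) :
    planeGauge g (z * w) = ‖z‖ * ‖w‖ * polarProfile g (z.arg + w.arg) := by
  rw [← planeGauge_polar (by positivity)]
  congr 1
  conv_lhs => rw [← Complex.norm_mul_exp_arg_mul_I z, ← Complex.norm_mul_exp_arg_mul_I w]
  push_cast
  rw [add_mul, Complex.exp_add]
  ring

theorem planeGauge_tangent (θ t : ℝ) :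
    planeGauge g (Complex.exp (θ * Complex.I) * (1 + t * Complex.I)) =
      Real.sqrt (1 + t ^ 2) * polarProfile g (θ + Real.arctan t) := by
  have h0 : Real.sqrt (1 + t ^ 2) ≠ 0 := (Real.sqrt_pos.2 (by positivity)).ne'
  have h0' : (Real.sqrt (1 + t ^ 2) : ℂ) ≠ 0 := by exact_mod_cast h0
  have e : (1 + t * Complex.I : ℂ) =
      Real.sqrt (1 + t ^ 2) * Complex.exp (Real.arctan t * Complex.I) := by
    rw [Complex.exp_mul_I, ← Complex.ofReal_cos, ← Complex.ofReal_sin, Real.cos_arctan,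
      Real.sin_arctan]
    push_cast
    field_simp
  rw [e, ← planeGauge_polar (Real.sqrt_nonneg _)]
  congr 1
  push_cast
  rw [add_mul, Complex.exp_add]
  ring

theorem convexOn_tangent_lift (h : ConvexOn ℝ univ (planeGauge g)) (θ : ℝ) :
    ConvexOn ℝ univ fun t => Real.sqrt (1 + t ^ 2) * polarProfile g (θ + Real.arctan t) := by
  refine ⟨convex_univ, fun x _ y _ a b ha hb hab => ?_⟩
  simp only [← planeGauge_tangent]
  refine (le_of_eq ?_).trans (h.2 (mem_univ _) (mem_univ _) ha hb hab)
  congr 1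
  simp only [Complex.real_smul, smul_eq_mul]
  have hab' : (a + b : ℂ) = 1 := by exact_mod_cast hab
  push_cast
  linear_combination -Complex.exp (θ * Complex.I) * hab'

/-- Inverts the lift `k`: `u(x) = cos(x - θ) k(tan(x - θ))`. At `θ` the cosine has value `1` and
derivative `0`, and the tangent has derivative `1`, so `d` is preserved. -/
theorem hasDerivWithinAt_of_tangent_lift {u : ℝ → ℝ} {θ d : ℝ} {S T : Set ℝ}
    (h : HasDerivWithinAt (fun t => Real.sqrt (1 + t ^ 2) * u (θ + Real.arctan t)) d S 0)
    (hT : MapsTo (fun x => Real.tan (x - θ)) T S)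
    (hT' : ∀ x ∈ T, x ∈ Ioo (θ - Real.pi / 2) (θ + Real.pi / 2)) :
    HasDerivWithinAt u d T θ := by
  have h1 : HasDerivWithinAt (fun x => Real.tan (x - θ)) 1 T θ := by
    have h' : HasDerivAt Real.tan (1 / Real.cos 0 ^ 2) 0 := Real.hasDerivAt_tan (by simp)
    have h'' : HasDerivAt (fun x => x - θ) 1 θ := (hasDerivAt_id θ).sub_const θ
    exact ((h'.comp_of_eq θ h'' (sub_self θ).symm).congr_deriv (by simp)).hasDerivWithinAt
  have h2 : HasDerivWithinAt (fun x => Real.cos (x - θ)) 0 T θ := by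
    have := (((hasDerivAt_id θ).sub_const θ).cos)
    exact (this.congr_deriv (by simp)).hasDerivWithinAt
  have h' : HasDerivWithinAt (fun t => Real.sqrt (1 + t ^ 2) * u (θ + Real.arctan t)) d S
      (Real.tan (θ - θ)) := by simpa using h
  have h3 := h2.mul (h'.comp θ h1 hT)
  refine (h3.congr_deriv (by simp)).congr ?_ (by simp)
  intro x hx
  have hx' := hT' x hx
  have hcos : 0 < Real.cos (x - θ) :=
    Real.cos_pos_of_mem_Ioo ⟨by linarith [hx'.1], by linarith [hx'.2]⟩
  have hsqrt : Real.sqrt (1 + Real.tan (x - θ) ^ 2) = (Real.cos (x - θ))⁻¹ := by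
    rw [← inv_inv (Real.sqrt _), Real.inv_sqrt_one_add_tan_sq hcos]
  simp only [Pi.mul_apply, Function.comp_apply]
  rw [hsqrt, Real.arctan_tan (by linarith [hx'.1]) (by linarith [hx'.2]),
    mul_inv_cancel_left₀ hcos.ne', add_sub_cancel]

/-- The lift is convex on the whole line, so it has ordered one-sided derivatives at `0`, which
carry over to the profile. -/
theorem exists_one_sided_deriv_polarProfile (h : ConvexOn ℝ univ (planeGauge g)) (θ : ℝ) :
    ∃ dl dr, dl ≤ dr ∧ HasDerivWithinAt (polarProfile g) dl (Iio θ) θ ∧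
      HasDerivWithinAt (polarProfile g) dr (Ioi θ) θ := by
  have hk := convexOn_tangent_lift h θ
  have h0 : (0 : ℝ) ∈ interior univ := by simp
  have hpi := Real.pi_pos
  refine ⟨_, _, hk.leftDeriv_le_rightDeriv_of_mem_interior h0, ?_, ?_⟩
  · have := hasDerivWithinAt_of_tangent_lift (T := Ioo (θ - Real.pi / 2) θ)
      (hk.hasDerivWithinAt_leftDeriv_of_mem_interior h0) ?_ ?_
    · exact this.mono_of_mem_nhdsWithin (Ioo_mem_nhdsLT (by linarith))
    · intro x hx
      exact Real.tan_neg_of_neg_of_pi_div_two_lt (by linarith [hx.2]) (by linarith [hx.1])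
    · exact fun x hx => ⟨hx.1, by linarith [hx.2]⟩
  · have := hasDerivWithinAt_of_tangent_lift (T := Ioo θ (θ + Real.pi / 2))
      (hk.hasDerivWithinAt_rightDeriv_of_mem_interior h0) ?_ ?_
    · exact this.mono_of_mem_nhdsWithin (Ioo_mem_nhdsGT (by linarith))
    · intro x hx
      exact Real.tan_pos_of_pos_of_lt_pi_div_two (by linarith [hx.1]) (by linarith [hx.2])
    · exact fun x hx => ⟨by linarith [hx.1], hx.2⟩

/-- If `u` is even about `θ`, its one-sided derivatives at `θ` are opposite. -/
theorem deriv_left_eq_neg_right {u : ℝ → ℝ} {θ dl dr : ℝ} (hu : ∀ x, u (2 * θ - x) = u x)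
    (hl : HasDerivWithinAt u dl (Iio θ) θ) (hr : HasDerivWithinAt u dr (Ioi θ) θ) :
    dl = -dr := by
  have hr' : HasDerivWithinAt u dr (Ioi θ) (2 * θ - θ) := by
    rwa [show 2 * θ - θ = θ by ring]
  have h := hr'.comp θ ((hasDerivAt_id θ).const_sub (2 * θ)).hasDerivWithinAt (s := Iio θ)
    (fun x hx => by simp only [mem_Ioi, mem_Iio] at *; linarith)
  have h' : HasDerivWithinAt u (dr * -1) (Iio θ) θ :=
    h.congr (fun x _ => (hu x).symm) (hu θ).symm
  rw [(uniqueDiffWithinAt_Iio θ).eq_deriv _ hl h', mul_neg_one]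

/-- The negative factor `-g²` reverses the order of one-sided derivatives when passing from `1 / g`
to `g`. -/
theorem hasDerivWithinAt_of_polarProfile {S : Set ℝ} {θ d : ℝ}
    (hgpos : ∀ θ ∈ Icc 0 (Real.pi / 3), 0 < g θ) (hθ : θ ∈ Icc 0 (Real.pi / 3))
    (h : HasDerivWithinAt (polarProfile g) d S θ)
    (hS : ∀ᶠ x in 𝓝[S] θ, x ∈ Icc 0 (Real.pi / 3)) :
    HasDerivWithinAt g (-d * g θ ^ 2) S θ := by
  have hu := polarProfile_eq (g := g) hθ
  have hgθ := hgpos θ hθ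
  have h' := h.fun_inv (by rw [hu]; positivity)
  rw [hu] at h'
  refine (h'.congr_deriv (by field_simp)).congr_of_eventuallyEq ?_ (by rw [hu, inv_inv])
  filter_upwards [hS] with x hx
  rw [polarProfile_eq hx, inv_inv]

theorem second_order_of_convexOn (hgpos : ∀ θ ∈ Icc 0 (Real.pi / 3), 0 < g θ)
    (h : ConvexOn ℝ univ (planeGauge g)) {O : Set ℝ} (hO : IsOpen O)
    (hO' : O ⊆ Icc 0 (Real.pi / 3))
    (hg : ∀ θ ∈ O, DifferentiableAt ℝ g θ ∧ DifferentiableAt ℝ (deriv g) θ)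
    {θ : ℝ} (hθ : θ ∈ O) :
    0 ≤ g θ ^ 2 + 2 * deriv g θ ^ 2 - g θ * deriv (deriv g) θ := by
  set u := polarProfile g
  have hgO : ∀ x ∈ O, 0 < g x := fun x hx => hgpos x (hO' hx)
  have hu : ∀ x ∈ O, HasDerivAt u (-deriv g x / g x ^ 2) x := by
    intro x hx
    refine ((hg x hx).1.hasDerivAt.fun_inv (hgO x hx).ne').congr_of_eventuallyEq ?_
    filter_upwards [hO.mem_nhds hx] with y hy
    exact polarProfile_eq (hO' hy)
  have hu' := fun x hx => hasDerivAt_deriv_inv (hgO x hx).ne' (hg x hx).1 (hg x hx).2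
  have hcont : ContinuousAt (fun t => θ + Real.arctan t) 0 := by
    exact (continuous_const.add Real.continuous_arctan).continuousAt
  have hnhds : ∀ᶠ t in 𝓝 (0 : ℝ), θ + Real.arctan t ∈ O :=
    hcont.eventually (hO.mem_nhds (by simpa using hθ))
  obtain ⟨ε, hε, hball⟩ := Metric.eventually_nhds_iff_ball.1 hnhds
  have hk := (convexOn_tangent_lift h θ).subset (subset_univ _) (convex_ball (0 : ℝ) ε)
  have h2 := hk.deriv_deriv_nonneg Metric.isOpen_ball
    (fun t ht => (hasDerivAt_tangent_lift (hu _ (hball t ht))).differentiableAt)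
    (Metric.mem_ball_self hε)
  have hd1 : deriv (fun t => Real.sqrt (1 + t ^ 2) * polarProfile g (θ + Real.arctan t)) =ᶠ[𝓝 0]
      fun t => (t * u (θ + Real.arctan t) +
        (-deriv g (θ + Real.arctan t) / g (θ + Real.arctan t) ^ 2)) / Real.sqrt (1 + t ^ 2) := by
    filter_upwards [hnhds] with t ht
    exact (hasDerivAt_tangent_lift (hu _ ht)).deriv
  have h0 : θ + Real.arctan 0 ∈ O := by simpa using hθ
  rw [hd1.deriv_eq, (hasDerivAt_deriv_tangent_lift (u' := fun x => -deriv g x / g x ^ 2)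
    (hu _ h0) (hu' _ h0)).deriv] at h2
  simp only [Real.arctan_zero, add_zero] at h2
  have hgθ := hgO θ hθ
  have e : u θ = (g θ)⁻¹ := polarProfile_eq (hO' hθ)
  rw [e] at h2
  norm_num at h2
  have e2 : (g θ)⁻¹ + (2 * deriv g θ ^ 2 - g θ * deriv (deriv g) θ) / g θ ^ 3 =
      (g θ ^ 2 + 2 * deriv g θ ^ 2 - g θ * deriv (deriv g) θ) / g θ ^ 3 := by
    field_simp; ring
  rw [e2, le_div_iff₀ (by positivity), zero_mul] at h2
  exact h2

/-! ### Sufficiency: from supports of the profile to convexity -/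

theorem continuous_planeGauge (hgc : ContinuousOn g (Icc 0 (Real.pi / 3)))
    (hgpos : ∀ θ ∈ Icc 0 (Real.pi / 3), 0 < g θ) : Continuous (planeGauge g) := by
  have hG : Continuous fun x => g ((1 / 3) * Real.arccos x) :=
    hgc.comp_continuous (by fun_prop) third_arccos_mem
  have hG0 : ∀ x, g ((1 / 3) * Real.arccos x) ≠ 0 := fun x => (hgpos _ (third_arccos_mem x)).ne'
  rw [continuous_iff_continuousAt]
  intro z
  rcases eq_or_ne z 0 with rfl | hz
  -- The angle has no limit at the origin; the bound `‖z‖ / min g` replaces it.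
  · obtain ⟨c, hc, hmin⟩ := isCompact_Icc.exists_isMinOn
      (nonempty_Icc.2 (by positivity : 0 ≤ Real.pi / 3)) hgc
    have hle : ∀ z, planeGauge g z ≤ ‖z‖ / g c := fun z =>
      div_le_div_of_nonneg_left (norm_nonneg z) (hgpos c hc) (hmin (third_arccos_mem _))
    rw [ContinuousAt, planeGauge_zero]
    refine squeeze_zero (planeGauge_nonneg hgpos) hle ?_
    have : Continuous fun z : ℂ => ‖z‖ / g c := by fun_prop
    simpa using this.tendsto 0
  · have h1 : ContinuousAt (fun z : ℂ => (z ^ 3).re / ‖z‖ ^ 3) z := by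
      refine ContinuousAt.div ?_ (by fun_prop) (by positivity)
      exact (Complex.continuous_re.comp (continuous_pow 3)).continuousAt
    exact ContinuousAt.div continuousAt_id.norm (hG.continuousAt.comp h1) (hG0 _)

/-- Times the modulus, `a cos φ + m sin φ` is real-linear in the plane, so a trigonometric support
of the profile is a linear support of the gauge near a whole ray. At the origin the zero functional
serves. -/
theorem convexOn_planeGauge_of_trig_support (hgc : ContinuousOn g (Icc 0 (Real.pi / 3)))
    (hgpos : ∀ θ ∈ Icc 0 (Real.pi / 3), 0 < g θ)
    (hs : ∀ θ ∈ Icc 0 (Real.pi / 3), ∃ m, ∀ᶠ φ in 𝓝 (0 : ℝ),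
      polarProfile g θ * Real.cos φ + m * Real.sin φ ≤ polarProfile g (θ + φ)) :
    ConvexOn ℝ univ (planeGauge g) := by
  have hs' : ∀ α : ℝ, ∃ m, ∀ᶠ φ in 𝓝 (0 : ℝ),
      polarProfile g α * Real.cos φ + m * Real.sin φ ≤ polarProfile g (α + φ) := by
    intro α
    obtain ⟨θ, hθ, h | h⟩ := exists_polarProfile_reduction α
    · obtain ⟨m, hm⟩ := hs θ hθ
      have h0 := h g 0
      rw [add_zero, add_zero] at h0
      exact ⟨m, hm.mono fun φ hφ => by rwa [h, h0]⟩
    · obtain ⟨m, hm⟩ := hs θ hθ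
      have h0 := h g 0
      rw [add_zero, sub_zero] at h0
      have hneg : Tendsto (fun x : ℝ => -x) (𝓝 0) (𝓝 0) := by
        simpa using (continuous_neg (G := ℝ)).tendsto 0
      -- The reduction reverses orientation here, which flips the slope.
      refine ⟨-m, (hneg.eventually hm).mono fun φ hφ => ?_⟩
      rw [h, h0]
      rw [Real.cos_neg, Real.sin_neg] at hφ
      rw [sub_eq_add_neg]
      linarith
  refine convexOn_of_locally_supported (continuous_planeGauge hgc hgpos) fun z => ?_
  rcases eq_or_ne z 0 with rfl | hz
  · exact ⟨0, Eventually.of_forall fun w => by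
      simpa [planeGauge_zero] using planeGauge_nonneg hgpos w⟩
  · obtain ⟨m, hm⟩ := hs' z.arg
    have hz0 : planeGauge g z = ‖z‖ * polarProfile g z.arg := by
      simpa using planeGauge_mul (g := g) z 1
    let l : ℂ →ₗ[ℝ] ℝ := ‖z‖ • ((polarProfile g z.arg) • Complex.reLm + m • Complex.imLm) ∘ₗ
      LinearMap.mulRight ℝ z⁻¹
    have hl : ∀ v, l v = ‖z‖ * (polarProfile g z.arg * (v * z⁻¹).re + m * (v * z⁻¹).im) :=
      fun v => rfl
    -- Measuring the angle from `z` puts it near `arg 1 = 0`, away from the branch cut.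
    have htend : Tendsto (fun w : ℂ => (w * z⁻¹).arg) (𝓝 z) (𝓝 0) := by
      have h1 : ContinuousAt Complex.arg (z * z⁻¹) := by
        rw [mul_inv_cancel₀ hz]
        exact Complex.continuousAt_arg (by simp)
      have h2 : ContinuousAt (fun w : ℂ => w * z⁻¹) z := by fun_prop
      have h3 : ContinuousAt (fun w : ℂ => (w * z⁻¹).arg) z :=
        ContinuousAt.comp (f := fun w : ℂ => w * z⁻¹) h1 h2
      simpa [ContinuousAt, mul_inv_cancel₀ hz] using h3
    refine ⟨l, (htend.eventually hm).mono fun w hw => ?_⟩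
    have hw' : w = z * (w * z⁻¹) := by field_simp
    have hlw : l (w - z) = l w - ‖z‖ * polarProfile g z.arg := by
      rw [map_sub, hl z, mul_inv_cancel₀ hz]
      simp
    rw [hlw, hz0, hl]
    conv_rhs => rw [hw', planeGauge_mul]
    generalize w * z⁻¹ = v at hw
    rw [← Complex.norm_mul_cos_arg v, ← Complex.norm_mul_sin_arg v]
    have := mul_le_mul_of_nonneg_left hw (mul_nonneg (norm_nonneg z) (norm_nonneg v))
    linarith

theorem eventually_nhds_zero_of_pos_neg {P : ℝ → Prop} (h0 : P 0) {a b : ℝ} (ha : 0 < a)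
    (hb : 0 < b) (hr : ∀ φ ∈ Ioo 0 a, P φ) (hl : ∀ φ ∈ Ioo 0 b, P (-φ)) :
    ∀ᶠ φ in 𝓝 (0 : ℝ), P φ := by
  filter_upwards [Ioo_mem_nhds (neg_lt_zero.2 hb) ha] with φ hφ
  rcases lt_trichotomy φ 0 with h | rfl | h
  · simpa using hl (-φ) ⟨by linarith, by linarith [hφ.1]⟩
  · exact h0
  · exact hr φ ⟨h, hφ.2⟩

theorem exists_gap_right {E : Set ℝ} (hE : E.Finite) {θ c : ℝ} (h : θ < c) :
    ∃ b, θ < b ∧ b ≤ c ∧ Ioo θ b ∩ E = ∅ := by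
  -- The point `θ` may itself be a corner, so it is removed from `E` first.
  have : (E \ {θ})ᶜ ∈ 𝓝[>] θ := mem_nhdsWithin_of_mem_nhds
    ((hE.subset sdiff_subset).isClosed.isOpen_compl.mem_nhds (by simp))
  obtain ⟨b, hb, hsub⟩ := (mem_nhdsGT_iff_exists_Ioo_subset' h).1 this
  refine ⟨min b c, lt_min hb h, min_le_right _ _, ?_⟩
  ext x
  simp only [mem_inter_iff, mem_empty_iff_false, iff_false]
  rintro ⟨hx, hxE⟩
  exact hsub ⟨hx.1, hx.2.trans_le (min_le_left _ _)⟩ ⟨hxE, hx.1.ne'⟩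

theorem exists_gap_left {E : Set ℝ} (hE : E.Finite) {θ c : ℝ} (h : c < θ) :
    ∃ b, b < θ ∧ c ≤ b ∧ Ioo b θ ∩ E = ∅ := by
  have : (E \ {θ})ᶜ ∈ 𝓝[<] θ := mem_nhdsWithin_of_mem_nhds
    ((hE.subset sdiff_subset).isClosed.isOpen_compl.mem_nhds (by simp))
  obtain ⟨b, hb, hsub⟩ := (mem_nhdsLT_iff_exists_Ioo_subset' h).1 this
  refine ⟨max b c, max_lt hb h, le_max_right _ _, ?_⟩
  ext x
  simp only [mem_inter_iff, mem_empty_iff_false, iff_false]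
  rintro ⟨hx, hxE⟩
  exact hsub ⟨(le_max_left _ _).trans_lt hx.1, hx.2⟩ ⟨hxE, hx.2.ne⟩

variable {E : Set ℝ}

/-- Finiteness of `E` leaves a smooth stretch to the right of `θ`. The sign of `sin φ` is recorded
so that the slope can be lowered afterwards. -/
theorem polarProfile_support_right (hE : E.Finite)
    (hgpos : ∀ θ ∈ Icc 0 (Real.pi / 3), 0 < g θ)
    (hg : ∀ θ ∈ Ioo 0 (Real.pi / 3) \ E, DifferentiableAt ℝ g θ ∧ DifferentiableAt ℝ (deriv g) θ)
    (hpos : ∀ θ ∈ Ioo 0 (Real.pi / 3) \ E,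
      0 ≤ g θ ^ 2 + 2 * deriv g θ ^ 2 - g θ * deriv (deriv g) θ)
    {θ d : ℝ} (hθ : θ ∈ Ico 0 (Real.pi / 3)) (hd : HasDerivWithinAt g d (Ici θ) θ) :
    ∃ a > 0, ∀ φ ∈ Ioo 0 a, 0 ≤ Real.sin φ ∧ polarProfile g θ * Real.cos φ +
      -d / g θ ^ 2 * Real.sin φ ≤ polarProfile g (θ + φ) := by
  obtain ⟨b, hb, hbc, hgap⟩ := exists_gap_right hE hθ.2
  have hmem : ∀ x ∈ Ioo θ b, x ∈ Ioo 0 (Real.pi / 3) \ E := fun x hx =>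
    ⟨⟨hθ.1.trans_lt hx.1, hx.2.trans_le hbc⟩, fun hxE => (hgap ▸ ⟨hx, hxE⟩ : x ∈ (∅ : Set ℝ))⟩
  have hpi := Real.pi_pos
  refine ⟨b - θ, sub_pos.2 hb, fun φ hφ => ⟨?_, ?_⟩⟩
  · exact (Real.sin_pos_of_pos_of_lt_pi hφ.1 (by linarith [hφ.2, hθ.1])).le
  · rw [polarProfile_eq (Ico_subset_Icc_self hθ),
      polarProfile_eq ⟨by linarith [hφ.1, hθ.1], by linarith [hφ.2]⟩]
    exact trig_support_inv_right hb (by linarith [hθ.1])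
      (fun x hx => hgpos x ⟨hθ.1.trans hx.1, hx.2.le.trans hbc⟩) hd (fun x hx => hg x (hmem x hx))
      (fun x hx => hpos x (hmem x hx)) hφ

theorem polarProfile_support_left (hE : E.Finite)
    (hgpos : ∀ θ ∈ Icc 0 (Real.pi / 3), 0 < g θ)
    (hg : ∀ θ ∈ Ioo 0 (Real.pi / 3) \ E, DifferentiableAt ℝ g θ ∧ DifferentiableAt ℝ (deriv g) θ)
    (hpos : ∀ θ ∈ Ioo 0 (Real.pi / 3) \ E,
      0 ≤ g θ ^ 2 + 2 * deriv g θ ^ 2 - g θ * deriv (deriv g) θ)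
    {θ d : ℝ} (hθ : θ ∈ Ioc 0 (Real.pi / 3)) (hd : HasDerivWithinAt g d (Iic θ) θ) :
    ∃ a > 0, ∀ φ ∈ Ioo 0 a, 0 ≤ Real.sin φ ∧ polarProfile g θ * Real.cos φ +
      d / g θ ^ 2 * Real.sin φ ≤ polarProfile g (θ - φ) := by
  obtain ⟨b, hb, hbc, hgap⟩ := exists_gap_left hE hθ.1
  have hmem : ∀ x ∈ Ioo b θ, x ∈ Ioo 0 (Real.pi / 3) \ E := fun x hx =>
    ⟨⟨hbc.trans_lt hx.1, hx.2.trans_le hθ.2⟩, fun hxE => (hgap ▸ ⟨hx, hxE⟩ : x ∈ (∅ : Set ℝ))⟩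
  have hpi := Real.pi_pos
  refine ⟨θ - b, sub_pos.2 hb, fun φ hφ => ⟨?_, ?_⟩⟩
  · exact (Real.sin_pos_of_pos_of_lt_pi hφ.1 (by linarith [hφ.2, hθ.2])).le
  · rw [polarProfile_eq (Ioc_subset_Icc_self hθ),
      polarProfile_eq ⟨by linarith [hφ.2], by linarith [hφ.1, hθ.2]⟩]
    exact trig_support_inv_left hb (by linarith [hθ.2])
      (fun x hx => hgpos x ⟨hbc.trans hx.1.le, hx.2.trans hθ.2⟩) hd (fun x hx => hg x (hmem x hx))
      (fun x hx => hpos x (hmem x hx)) hφ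

theorem convexOn_planeGauge_iff (hgc : ContinuousOn g (Icc 0 (Real.pi / 3)))
    (hgpos : ∀ θ ∈ Icc 0 (Real.pi / 3), 0 < g θ)
    (hE : E.Finite) (hEsub : E ⊆ Ioo 0 (Real.pi / 3))
    (hg : ∀ θ ∈ Ioo 0 (Real.pi / 3) \ E,
      DifferentiableAt ℝ g θ ∧ DifferentiableAt ℝ (deriv g) θ) :
    ConvexOn ℝ univ (planeGauge g) ↔
      (∀ θ ∈ Ioo 0 (Real.pi / 3) \ E,
        0 ≤ g θ ^ 2 + 2 * deriv g θ ^ 2 - g θ * deriv (deriv g) θ) ∧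
      (∃ d, HasDerivWithinAt g d (Icc 0 (Real.pi / 3)) 0 ∧ d ≤ 0) ∧
      (∃ d, HasDerivWithinAt g d (Icc 0 (Real.pi / 3)) (Real.pi / 3) ∧ 0 ≤ d) ∧
      (∀ θ ∈ E, ¬ DifferentiableAt ℝ g θ →
        ∃ dl dr, HasDerivWithinAt g dl (Iio θ) θ ∧
          HasDerivWithinAt g dr (Ioi θ) θ ∧ dr < dl) := by
  have hpi : 0 < Real.pi / 3 := by positivity
  have h0mem : (0 : ℝ) ∈ Icc 0 (Real.pi / 3) := ⟨le_rfl, hpi.le⟩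
  have h1mem : Real.pi / 3 ∈ Icc 0 (Real.pi / 3) := ⟨hpi.le, le_rfl⟩
  constructor
  · intro h
    refine ⟨fun θ hθ => second_order_of_convexOn hgpos h (isOpen_Ioo.sdiff hE.isClosed)
      (fun x hx => Ioo_subset_Icc_self hx.1) hg hθ, ?_, ?_, ?_⟩
    · obtain ⟨dl, dr, hle, hl, hr⟩ := exists_one_sided_deriv_polarProfile h 0
      -- Evenness about `0` gives `dl = -dr`, so `dl ≤ dr` says `0 ≤ dr`.
      have := deriv_left_eq_neg_right (fun x => by simp [polarProfile_neg]) hl hr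
      have h' := (hasDerivWithinAt_Ioi_iff_Ici.1 hr).mono
        (Icc_subset_Ici_self : Icc 0 (Real.pi / 3) ⊆ _)
      refine ⟨_, hasDerivWithinAt_of_polarProfile hgpos h0mem h' self_mem_nhdsWithin, ?_⟩
      nlinarith [mul_nonneg (by linarith : 0 ≤ dr) (sq_nonneg (g 0))]
    · obtain ⟨dl, dr, hle, hl, hr⟩ := exists_one_sided_deriv_polarProfile h (Real.pi / 3)
      have := deriv_left_eq_neg_right polarProfile_reflect hl hr
      have h' := (hasDerivWithinAt_Iio_iff_Iic.1 hl).mono (Icc_subset_Iic_self : Icc 0 (Real.pi / 3) ⊆ _)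
      refine ⟨_, hasDerivWithinAt_of_polarProfile hgpos h1mem h' self_mem_nhdsWithin, ?_⟩
      exact mul_nonneg (by linarith) (sq_nonneg _)
    · intro θ hθE hnd
      have hθ := hEsub hθE
      have hθ' := Ioo_subset_Icc_self hθ
      obtain ⟨dl, dr, hle, hl, hr⟩ := exists_one_sided_deriv_polarProfile h θ
      have hmem : Icc 0 (Real.pi / 3) ∈ 𝓝 θ := Icc_mem_nhds hθ.1 hθ.2
      have hl' := hasDerivWithinAt_of_polarProfile hgpos hθ' hl (mem_nhdsWithin_of_mem_nhds hmem)
      have hr' := hasDerivWithinAt_of_polarProfile hgpos hθ' hr (mem_nhdsWithin_of_mem_nhds hmem)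
      refine ⟨_, _, hl', hr', ?_⟩
      -- Equality would make `g` differentiable at `θ`, which is excluded at a corner.
      have hlt : dl < dr := by
        refine lt_of_le_of_ne hle ?_
        rintro rfl
        exact hnd (hasDerivAt_of_left_right hl' hr').differentiableAt
      have hgθ := hgpos θ hθ'
      have : 0 < g θ ^ 2 := by positivity
      nlinarith
  · rintro ⟨hpos, ⟨d₀, hd₀, hd₀'⟩, ⟨d₁, hd₁, hd₁'⟩, hcorner⟩
    refine convexOn_planeGauge_of_trig_support hgc hgpos fun θ hθ => ?_
    rcases hθ.1.eq_or_lt with rfl | h0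
    · obtain ⟨a, ha, hsup⟩ := polarProfile_support_right hE hgpos hg hpos ⟨le_rfl, hpi⟩
        (hd₀.mono_of_mem_nhdsWithin (Icc_mem_nhdsGE hpi))
      have hm : 0 ≤ -d₀ / g 0 ^ 2 := div_nonneg (by linarith) (sq_nonneg _)
      -- The sign of `d₀` makes the right slope nonnegative, so slope `0` works on the right, and by
      -- mirror symmetry on the left.
      refine ⟨0, eventually_nhds_zero_of_pos_neg (by simp) ha ha ?_ ?_⟩
      · intro φ hφ
        nlinarith [hsup φ hφ, mul_nonneg hm (hsup φ hφ).1]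
      · intro φ hφ
        rw [Real.cos_neg, zero_add, polarProfile_neg]
        have := (hsup φ hφ).2
        rw [zero_add] at this
        nlinarith [mul_nonneg hm (hsup φ hφ).1]
    rcases hθ.2.eq_or_lt with rfl | h1
    · obtain ⟨a, ha, hsup⟩ := polarProfile_support_left hE hgpos hg hpos ⟨hpi, le_rfl⟩
        (hd₁.mono_of_mem_nhdsWithin (Icc_mem_nhdsLE hpi))
      have hm : 0 ≤ d₁ / g (Real.pi / 3) ^ 2 := div_nonneg hd₁' (sq_nonneg _)
      refine ⟨0, eventually_nhds_zero_of_pos_neg (by simp) ha ha ?_ ?_⟩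
      · intro φ hφ
        rw [← polarProfile_reflect (Real.pi / 3 + φ),
          show 2 * (Real.pi / 3) - (Real.pi / 3 + φ) = Real.pi / 3 - φ by ring]
        nlinarith [hsup φ hφ, mul_nonneg hm (hsup φ hφ).1]
      · intro φ hφ
        rw [Real.cos_neg, ← sub_eq_add_neg]
        nlinarith [hsup φ hφ, mul_nonneg hm (hsup φ hφ).1]
    have hlr : ∃ dl dr, HasDerivWithinAt g dl (Iio θ) θ ∧
        HasDerivWithinAt g dr (Ioi θ) θ ∧ dr ≤ dl := by
      by_cases hdiff : DifferentiableAt ℝ g θ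
      · exact ⟨_, _, hdiff.hasDerivAt.hasDerivWithinAt, hdiff.hasDerivAt.hasDerivWithinAt, le_rfl⟩
      · have hθE : θ ∈ E := by
          by_contra hθE
          exact hdiff (hg θ ⟨⟨h0, h1⟩, hθE⟩).1
        obtain ⟨dl, dr, hl, hr, hlt⟩ := hcorner θ hθE hdiff
        exact ⟨dl, dr, hl, hr, hlt.le⟩
    obtain ⟨dl, dr, hl, hr, hle⟩ := hlr
    obtain ⟨a, ha, hsr⟩ := polarProfile_support_right hE hgpos hg hpos ⟨h0.le, h1⟩
      (hasDerivWithinAt_Ioi_iff_Ici.1 hr)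
    obtain ⟨b, hb, hsl⟩ := polarProfile_support_left hE hgpos hg hpos ⟨h0, h1.le⟩
      (hasDerivWithinAt_Iio_iff_Iic.1 hl)
    -- This is the right derivative of `1 / g`; since `dr ≤ dl` it is at least the left one, so it
    -- also supports on the left.
    refine ⟨-dr / g θ ^ 2, eventually_nhds_zero_of_pos_neg (by simp) ha hb
      (fun φ hφ => (hsr φ hφ).2) fun φ hφ => ?_⟩
    rw [Real.cos_neg, Real.sin_neg, ← sub_eq_add_neg]
    have hc : dr / g θ ^ 2 ≤ dl / g θ ^ 2 := by gcongr
    have := mul_le_mul_of_nonneg_right hc (hsl φ hφ).1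
    rw [neg_div]
    linarith [(hsl φ hφ).2]

theorem convexOn_iff_deriv2_nonneg {D : Set ℝ} (hD : Convex ℝ D) {f : ℝ → ℝ}
    (hfc : ContinuousOn f D)
    (hf : ∀ p ∈ interior D, DifferentiableAt ℝ f p ∧ DifferentiableAt ℝ (deriv f) p) :
    ConvexOn ℝ D f ↔ ∀ p ∈ interior D, 0 ≤ deriv (deriv f) p := by
  constructor
  · intro h p hp
    exact (h.subset interior_subset hD.interior).deriv_deriv_nonneg isOpen_interior
      (fun x hx => (hf x hx).1) hp
  · intro h
    exact convexOn_of_deriv2_nonneg hD hfc (fun x hx => (hf x hx).1.differentiableWithinAt)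
      (fun x hx => (hf x hx).2.differentiableWithinAt) h

end YieldFunction

end

theorem theorem4
    (D : Set ℝ) (hD : Convex ℝ D) (hDne : D.Nonempty)
    (f : ℝ → ℝ) (hfc : ContinuousOn f D)
    (hf : ∀ p ∈ interior D, DifferentiableAt ℝ f p ∧ DifferentiableAt ℝ (deriv f) p)
    (g : ℝ → ℝ) (hgc : ContinuousOn g (Set.Icc 0 (Real.pi / 3)))
    (hgpos : ∀ θ ∈ Set.Icc 0 (Real.pi / 3), 0 < g θ)
    (E : Set ℝ) (hE : E.Finite) (hEsub : E ⊆ Set.Ioo 0 (Real.pi / 3))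
    (hg : ∀ θ ∈ Set.Ioo 0 (Real.pi / 3) \ E,
      DifferentiableAt ℝ g θ ∧ DifferentiableAt ℝ (deriv g) θ) :
    (ConvexOn ℝ (YieldFunction.domain D) (YieldFunction.yieldFun f g) ↔
      (∀ p ∈ interior D, 0 ≤ deriv (deriv f) p) ∧
      (∀ θ ∈ Set.Ioo 0 (Real.pi / 3) \ E,
        0 ≤ g θ ^ 2 + 2 * deriv g θ ^ 2 - g θ * deriv (deriv g) θ) ∧
      (∃ d, HasDerivWithinAt g d (Set.Icc 0 (Real.pi / 3)) 0 ∧ d ≤ 0) ∧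
      (∃ d, HasDerivWithinAt g d (Set.Icc 0 (Real.pi / 3)) (Real.pi / 3) ∧ 0 ≤ d) ∧
      (∀ θ ∈ E, ¬ DifferentiableAt ℝ g θ →
        ∃ dl dr, HasDerivWithinAt g dl (Set.Iio θ) θ ∧
          HasDerivWithinAt g dr (Set.Ioi θ) θ ∧ dr < dl)) ∧
    ((∀ p ∈ D, f p ≤ 0) → (∃ p ∈ D, f p < 0) →
      (ConvexOn ℝ (YieldFunction.domain D) (YieldFunction.yieldFun f g) ↔
        (∀ θ ∈ Set.Icc 0 (Real.pi / 3), Convex ℝ (YieldFunction.meridianSection D f g θ)) ∧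
        (∀ p ∈ D, Convex ℝ (YieldFunction.deviatoricSection f g p)))) := by
  refine ⟨?_, fun hf₀ hf₁ => YieldFunction.convexOn_yieldFun_iff_sections hD hgpos hf₀ hf₁⟩
  rw [YieldFunction.convexOn_yieldFun_iff hD hDne,
    YieldFunction.convexOn_iff_deriv2_nonneg hD hfc hf,
    YieldFunction.convexOn_planeGauge_iff hgc hgpos hE hEsub hg]
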